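/- **Theorem (linearisability of the Round-Based Register).** Consider a system of $n$ nodes $1,\dots,n$ and a type of values with a literal $\mathtt{undef}$. Each node runs an acceptor and a proposer in parallel. Nodes exchange messages over an asynchronous network (an unordered bag: no message is created, modified or duplicated, delays are arbitrary, and a message may be received by either component of its destination, which skips messages that match none of its cases). Steps of the components interleave arbitrarily, and any component may stop at any point. *Implementation.* The acceptor at node $j$ keeps $v:=\mathtt{undef}$, $r:=0$, $w:=0$ and treats received messages one after the other. On $[\mathtt{RE},k]$ from $i$ it sends $[\mathtt{nackRE},k]$ to $i$ if $k<r$, and otherwise atomically sets $r:=k$ and sends $[\mathtt{ackRE},k,v,w]$ to $i$. On $[\mathtt{WR},k,v']$ from $i$ it sends $[\mathtt{nackWR},k]$ to $i$ if $k<r$, and otherwise atomically sets $r:=k$, $w:=k$, $v:=v'$ and sends $[\mathtt{ackWR},k]$ to $i$. Proposers execute, one at a time per node, operations $\mathtt{read}(k)$ and $\mathtt{write}(k,v)$ with $v\neq\mathtt{undef}$, where round $k$ may be used only by node $((k-1)\bmod n)+1$. The operation $\mathtt{read}(k)$ sends $[\mathtt{RE},k]$ to nodes $1,\dots,n$ one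 by one, sets $maxKW:=0$, $maxV:=\mathtt{undef}$, $Q:=\emptyset$, and then repeatedly receives a message. On $[\mathtt{ackRE},k,v,kW]$ from $j$ it adds $j$ to $Q$ and, if $kW\ge maxKW$, sets $maxKW:=kW$, $maxV:=v$. On $[\mathtt{nackRE},k]$ it returns $(\mathtt{false},\_)$. Whenever $|Q|=\lceil (n+1)/2\rceil$ after a message has been treated, it returns $(\mathtt{true},maxV)$. The operation $\mathtt{write}(k,v)$ sends $[\mathtt{WR},k,v]$ to nodes $1,\dots,n$ one by one, collects in $Q$ the senders of $[\mathtt{ackWR},k]$ in the same way, returns $\mathtt{true}$ when $|Q|=\lceil (n+1)/2\rceil$ and returns $\mathtt{false}$ on $[\mathtt{nackWR},k]$. *Specification.* The abstract state is $vRR:=\mathtt{undef}$, $roundRR:=0$, $valsRR:=\{\mathtt{undef}\}$. Both operations are atomic and may be executed only by node $((k-1)\bmod n)+1$. $\mathtt{read}(k)$ chooses any $vD\in valsRR$ and any Boolean $b$. If $b$ is false it returns $(\mathtt{false},\_)$. If $b$ is true and $k\ge roundRR$, it sets $roundRR:=k$ and returns $(\mathtt{true},vRR)$ if $vRR\ne\mathtt{undef}$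 and $(\mathtt{true},vD)$ otherwise. If $b$ is true and $k<roundRR$ it returns $(\mathtt{true},vD)$. $\mathtt{write}(k,v)$ requires $v\neq\mathtt{undef}$, chooses any Boolean $b$, and adds $v$ to $valsRR$. If $b$ is true and $k\ge roundRR$, it sets $roundRR:=k$, $vRR:=v$ and returns $\mathtt{true}$; otherwise it returns $\mathtt{false}$. *Use of the register.* The callers follow the discipline of round-based consensus: rounds are positive; each round is used for at most one $\mathtt{read}$ and at most one $\mathtt{write}$; $\mathtt{write}(k,v)$ is invoked only after $\mathtt{read}(k)$ has returned some $(\mathtt{true},v')$, and $v=v'$ unless $v'=\mathtt{undef}$. *Claim.* For every $n$, the history of invocations and responses of every finite execution of the implementation in which the callers follow this discipline is linearisable with respect to the specification. That is, the completed operations, with the results that they returned, together with some of the pending ones, with suitable results, can be put into a sequence that is an execution of the specification from its initial state and in which an operation that returned before another one was invoked comes before it. -/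

import Mathlib

namespace RBRegister

/-! ### Histories of the register, and its interface -/

/-- Operations of the register. Values live in `Option V`, with `none` the literal `undef`;
rounds are natural numbers. -/
inductive Op (V : Type*) where
  | read (k : ℕ)
  | write (k : ℕ) (vW : Option V)

/-- Results: `readOk v` is `(true, v)`, `readFail` is `(false, _)` (the second component is a
wildcard, so it is not recorded), and `wrote b` is the Boolean returned by a write. -/
inductive Ret (V : Type*) where
  | readOk (v : Option V)
  | readFail
  | wrote (b : Bool)

/-- Interface events of node `i`: invocations and responses. -/
inductive Event (V : Type*) where
  | inv (i : ℕ) (op : Op V)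
  | res (i : ℕ) (r : Ret V)

/-- The node at which an event happens. -/
def Event.node {V : Type*} : Event V → ℕ
  | .inv i _ => i
  | .res i _ => i

/-- The node that may use round `k` in a system with nodes `1, …, n`: `((k - 1) mod n) + 1`. -/
def owner (n k : ℕ) : ℕ := (k - 1) % n + 1

/-- The event at position `p` of `h` is the invocation of `op` by node `i`. -/
def InvokedAt {V : Type*} (h : List (Event V)) (p i : ℕ) (op : Op V) : Prop :=
  h[p]? = some (.inv i op)

/-- The event at position `q` of `h` is the response, with result `r`, that matches the invocation
by node `i` at position `p`: it is the next event of node `i` after `p`. -/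
def RespondedAt {V : Type*} (h : List (Event V)) (p q i : ℕ) (r : Ret V) : Prop :=
  p < q ∧ h[q]? = some (.res i r) ∧
    ∀ m e, p < m → m < q → h[m]? = some e → e.node ≠ i

/-- The operation by node `i` invoked at position `p` has returned before position `p'`. -/
def ReturnedBefore {V : Type*} (h : List (Event V)) (p i p' : ℕ) : Prop :=
  ∃ q r, RespondedAt h p q i r ∧ q < p'

/-! ### Linearisability with respect to an atomic specification -/

/-- An operation in a sequential execution: the position `pos` of its invocation in the concurrent
history identifies it. -/
structure OpRec (V : Type*) where
  pos : ℕ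
  node : ℕ
  op : Op V
  ret : Ret V

/-- `SpecRun step s L s'`: the atomic operations of `L`, executed one after the other from the
abstract state `s`, can return the results recorded in `L` and end in the state `s'`. -/
inductive SpecRun {V S : Type*} (step : ℕ → Op V → S → Ret V → S → Prop) :
    S → List (OpRec V) → S → Prop
  | nil (s : S) : SpecRun step s [] s
  | cons {s s' s'' : S} {x : OpRec V} {L : List (OpRec V)} :
      step x.node x.op s x.ret s' → SpecRun step s' L s'' → SpecRun step s (x :: L) s''

/-- `L` is a linearisation of the history `h`: it consists of operations invoked in `h`, each at
most once, contains every completed operation, with the result that it has in `h`, possibly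
contains pending operations, with some result, preserves the real-time order of `h`, and is
an execution of the specification from the initial state. -/
structure IsLinearisation {V S : Type*} (step : ℕ → Op V → S → Ret V → S → Prop) (init : S)
    (h : List (Event V)) (L : List (OpRec V)) : Prop where
  nodup : (L.map OpRec.pos).Nodup
  invoked : ∀ x ∈ L, InvokedAt h x.pos x.node x.op
  complete : ∀ p q i op r, InvokedAt h p i op → RespondedAt h p q i r →
    (⟨p, i, op, r⟩ : OpRec V) ∈ L
  realTime : L.Pairwise fun x y => ¬ ReturnedBefore h y.pos y.node x.pos
  legal : ∃ s, SpecRun step init L s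

/-- Linearisability of a finite history with respect to an atomic specification. -/
def Linearisable {V S : Type*} (step : ℕ → Op V → S → Ret V → S → Prop) (init : S)
    (h : List (Event V)) : Prop :=
  ∃ L, IsLinearisation step init h L

/-! ### The non-deterministic atomic specification -/

/-- Abstract state: decided value, current round, and values possibly proposed so far. -/
structure SpecState (V : Type*) where
  vRR : Option V
  roundRR : ℕ
  valsRR : Set (Option V)

def SpecState.init (V : Type*) : SpecState V := ⟨none, 0, {none}⟩

open Classical in
/-- The deterministic body of the specification of `read(k)`, for a choice of `vD` and `b`. -/
noncomputable def specReadBody {V : Type*} (k : ℕ) (vD : Option V) (b : Bool) (s : SpecState V) :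
    Ret V × SpecState V :=
  if b = true then
    if k ≥ s.roundRR then
      (.readOk (if s.vRR ≠ none then s.vRR else vD), { s with roundRR := k })
    else (.readOk vD, s)
  else (.readFail, s)

/-- The deterministic body of the specification of `write(k, vW)`, for a choice of `b`. -/
def specWriteBody {V : Type*} (k : ℕ) (vW : Option V) (b : Bool) (s : SpecState V) :
    Ret V × SpecState V :=
  if b = true ∧ k ≥ s.roundRR then
    (.wrote true, { vRR := vW, roundRR := k, valsRR := s.valsRR ∪ {vW} })
  else (.wrote false, { s with valsRR := s.valsRR ∪ {vW} })

/-- One atomic operation of the specification, executed by node `i`: the unspecified `vD` and `b`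
are chosen arbitrarily, subject to the `assume` statements. -/
def SpecStep {V : Type*} (n i : ℕ) (op : Op V) (s : SpecState V) (r : Ret V) (s' : SpecState V) :
    Prop :=
  match op with
  | .read k => ∃ (vD : Option V) (b : Bool),
      vD ∈ s.valsRR ∧ i = owner n k ∧ (r, s') = specReadBody k vD b s
  | .write k vW => ∃ b : Bool,
      vW ≠ none ∧ i = owner n k ∧ (r, s') = specWriteBody k vW b s

/-! ### The message-passing implementation -/

/-- Contents of messages. -/
inductive Msg (V : Type*) where
  | RE (k : ℕ)
  | WR (k : ℕ) (v : Option V)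
  | ackRE (k : ℕ) (v : Option V) (w : ℕ)
  | nackRE (k : ℕ)
  | ackWR (k : ℕ)
  | nackWR (k : ℕ)

/-- A message in transit, from node `src` to node `dst`. -/
structure Packet (V : Type*) where
  src : ℕ
  dst : ℕ
  msg : Msg V

/-- The number `⌈(n+1)/2⌉` of acknowledgements that an operation waits for. -/
def quorum (n : ℕ) : ℕ := ⌈((n : ℚ) + 1) / 2⌉₊

/-- Local state of an acceptor: value `v`, read round `r`, write round `w`, and the message (with
its sender) that it has received and not yet treated, if any. -/
structure Acceptor (V : Type*) where
  v : Option V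
  r : ℕ
  w : ℕ
  job : Option (ℕ × Msg V)

/-- The acceptor's `switch` on a received message: new `v`, `r`, `w`, and the reply, if any. -/
def Acceptor.handle {V : Type*} (a : Acceptor V) (m : Msg V) : Acceptor V × Option (Msg V) :=
  match m with
  | .RE k =>
      if k < a.r then (⟨a.v, a.r, a.w, none⟩, some (.nackRE k))
      else (⟨a.v, k, a.w, none⟩, some (.ackRE k a.v a.w))
  | .WR k vW =>
      if k < a.r then (⟨a.v, a.r, a.w, none⟩, some (.nackWR k))
      else (⟨vW, k, k, none⟩, some (.ackWR k))
  | _ => (⟨a.v, a.r, a.w, none⟩, none)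

/-- Control state of the proposer side of a node: `idle` between operations; in the `for` loop of a
`read` or `write`, about to send to node `j`; in the receive loop, with the current values of the
local variables; or about to return the result `r`. -/
inductive Proposer (V : Type*) where
  | idle
  | readSend (k j : ℕ)
  | readLoop (k maxKW : ℕ) (maxV : Option V) (Q : Finset ℕ)
  | writeSend (k : ℕ) (vW : Option V) (j : ℕ)
  | writeLoop (k : ℕ) (vW : Option V) (Q : Finset ℕ)
  | ret (r : Ret V)

/-- The test `|Q| = ⌈(n+1)/2⌉` at the end of an iteration of the loop of `read`. -/
def readTest {V : Type*} (n k maxKW : ℕ) (maxV : Option V) (Q : Finset ℕ) : Proposer V :=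
  if Q.card = quorum n then .ret (.readOk maxV) else .readLoop k maxKW maxV Q

/-- One iteration of the loop of `read`, when the message `m` from node `j` is received. -/
def readRecv {V : Type*} (n k maxKW : ℕ) (maxV : Option V) (Q : Finset ℕ) (j : ℕ) (m : Msg V) :
    Proposer V :=
  match m with
  | .ackRE k' v kW =>
      if k' = k then
        if kW ≥ maxKW then readTest n k kW v (Q ∪ {j})
        else readTest n k maxKW maxV (Q ∪ {j})
      else readTest n k maxKW maxV Q
  | .nackRE k' => if k' = k then .ret .readFail else readTest n k maxKW maxV Q
  | _ => readTest n k maxKW maxV Q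

/-- The test `|Q| = ⌈(n+1)/2⌉` at the end of an iteration of the loop of `write`. -/
def writeTest {V : Type*} (n k : ℕ) (vW : Option V) (Q : Finset ℕ) : Proposer V :=
  if Q.card = quorum n then .ret (.wrote true) else .writeLoop k vW Q

/-- One iteration of the loop of `write`, when the message `m` from node `j` is received. -/
def writeRecv {V : Type*} (n k : ℕ) (vW : Option V) (Q : Finset ℕ) (j : ℕ) (m : Msg V) :
    Proposer V :=
  match m with
  | .ackWR k' => if k' = k then writeTest n k vW (Q ∪ {j}) else writeTest n k vW Q
  | .nackWR k' => if k' = k then .ret (.wrote false) else writeTest n k vW Q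
  | _ => writeTest n k vW Q

/-- Global state: the acceptor and the proposer of every node, and the messages in transit. -/
structure State (V : Type*) where
  acc : ℕ → Acceptor V
  prop : ℕ → Proposer V
  net : Multiset (Packet V)

def State.init (V : Type*) : State V := ⟨fun _ => ⟨none, 0, 0, none⟩, fun _ => .idle, 0⟩

/-- Steps of the system with nodes `1, …, n`, each of which runs an acceptor and a proposer in
parallel; a step is labelled with the interface event that it produces, if any. The network is an
unordered bag of messages: a message in transit may be received at any later time, by either
component of its destination node that executes `receive` (which skips a message that matches none
of its cases). -/
inductive Step {V : Type*} (n : ℕ) : State V → Option (Event V) → State V → Prop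
  | callRead (s : State V) (i k : ℕ) :
      i ∈ Finset.Icc 1 n → s.prop i = .idle → i = owner n k →
      Step n s (some (.inv i (.read k)))
        { s with prop := Function.update s.prop i (.readSend k 1) }
  | callWrite (s : State V) (i k : ℕ) (vW : Option V) :
      i ∈ Finset.Icc 1 n → s.prop i = .idle → vW ≠ none → i = owner n k →
      Step n s (some (.inv i (.write k vW)))
        { s with prop := Function.update s.prop i (.writeSend k vW 1) }
  | sendRead (s : State V) (i k j : ℕ) :
      s.prop i = .readSend k j → j ≤ n →
      Step n s none
        { s with
          prop := Function.update s.prop i (.readSend k (j + 1))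
          net := ⟨i, j, .RE k⟩ ::ₘ s.net }
  | sentRead (s : State V) (i k j : ℕ) :
      s.prop i = .readSend k j → ¬ j ≤ n →
      Step n s none { s with prop := Function.update s.prop i (.readLoop k 0 none ∅) }
  | sendWrite (s : State V) (i k : ℕ) (vW : Option V) (j : ℕ) :
      s.prop i = .writeSend k vW j → j ≤ n →
      Step n s none
        { s with
          prop := Function.update s.prop i (.writeSend k vW (j + 1))
          net := ⟨i, j, .WR k vW⟩ ::ₘ s.net }
  | sentWrite (s : State V) (i k : ℕ) (vW : Option V) (j : ℕ) :
      s.prop i = .writeSend k vW j → ¬ j ≤ n →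
      Step n s none { s with prop := Function.update s.prop i (.writeLoop k vW ∅) }
  | recvRead (s : State V) (i k maxKW : ℕ) (maxV : Option V) (Q : Finset ℕ) (j : ℕ) (m : Msg V)
      (M : Multiset (Packet V)) :
      s.prop i = .readLoop k maxKW maxV Q → s.net = ⟨j, i, m⟩ ::ₘ M →
      Step n s none
        { s with
          prop := Function.update s.prop i (readRecv n k maxKW maxV Q j m)
          net := M }
  | recvWrite (s : State V) (i k : ℕ) (vW : Option V) (Q : Finset ℕ) (j : ℕ) (m : Msg V)
      (M : Multiset (Packet V)) :
      s.prop i = .writeLoop k vW Q → s.net = ⟨j, i, m⟩ ::ₘ M →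
      Step n s none
        { s with
          prop := Function.update s.prop i (writeRecv n k vW Q j m)
          net := M }
  | doReturn (s : State V) (i : ℕ) (r : Ret V) :
      s.prop i = .ret r →
      Step n s (some (.res i r)) { s with prop := Function.update s.prop i .idle }
  | accRecv (s : State V) (i j : ℕ) (m : Msg V) (M : Multiset (Packet V)) :
      j ∈ Finset.Icc 1 n → (s.acc j).job = none → s.net = ⟨i, j, m⟩ ::ₘ M →
      Step n s none
        { s with
          acc := Function.update s.acc j { s.acc j with job := some (i, m) }
          net := M }
  | accHandle (s : State V) (i j : ℕ) (m : Msg V) :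
      (s.acc j).job = some (i, m) →
      Step n s none
        { s with
          acc := Function.update s.acc j ((s.acc j).handle m).1
          net := match ((s.acc j).handle m).2 with
            | some reply => ⟨j, i, reply⟩ ::ₘ s.net
            | none => s.net }

/-- `Exec n h s`: some finite execution of the system with nodes `1, …, n`, from the initial state
to `s`, produces the history `h`. -/
inductive Exec {V : Type*} (n : ℕ) : List (Event V) → State V → Prop
  | init : Exec n [] (State.init V)
  | silent {h : List (Event V)} {s s' : State V} :
      Exec n h s → Step n s none s' → Exec n h s'
  | visible {h : List (Event V)} {s s' : State V} {e : Event V} :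
      Exec n h s → Step n s (some e) s' → Exec n (h ++ [e]) s'

/-! ### The discipline of the callers -/

/-- The register is used in the way of round-based consensus: rounds are positive; each round is
used for at most one `read` and at most one `write`; and `write(k, vW)` is invoked only after
`read(k)` has returned some `(true, v)`, with `vW = v` unless `v` is `undef`. -/
structure RoundDiscipline {V : Type*} (h : List (Event V)) : Prop where
  readPos : ∀ p i k, InvokedAt h p i (.read k) → 1 ≤ k
  readOnce : ∀ p p' i i' k, InvokedAt h p i (.read k) → InvokedAt h p' i' (.read k) → p = p'
  writeOnce : ∀ p p' i i' k vW vW', InvokedAt h p i (.write k vW) →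
    InvokedAt h p' i' (.write k vW') → p = p'
  readFirst : ∀ p i k vW, InvokedAt h p i (.write k vW) →
    ∃ p' q v, InvokedAt h p' i (.read k) ∧ RespondedAt h p' q i (.readOk v) ∧ q < p ∧
      (v = none ∨ vW = v)

end RBRegister

namespace RBRegister

variable {V : Type*} {n : ℕ} {h : List (Event V)}

/-! ### Histories -/

/-! The proof has two halves, joined by `Coherent`, which speaks of histories alone.

Message passing: ghost relations record which acknowledgements and acceptances each acceptor has
made. Its read round never decreases. Hence, having acknowledged `read(k)` with write round `w`, it
never accepts a round strictly between `w` and `k`; and once its read round has reached `k`, it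
newly accepts no round below `k` (`Barrier`). Any two quorums meet (`quorum_inter`), which yields
three facts. If `write(k, v)` succeeds, every successful read of a higher round returns `v`, by
induction on the round of the read: the reader sees either that write or a write of an intermediate
round, whose value came from its own read. A successful write is invoked before any successful
operation of a higher round returns (`Inv.invoked_lt`). A value read is `undef` or belongs to a
write of a lower round invoked before the response.

Order: each operation gets a point between its invocation and its response. Reads take effect at
their response and unsuccessful writes at their invocation. Successful writes must follow the order
of rounds, which their own invocations need not do; each is therefore delayed to the latest
invocation of a successful write of the same or a lower round. This point is monotone in the round,
does not exceed the response, and precedes the response of every successful read of a higher round.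
Ties are broken by round. Pending reads are dropped. Pending writes are kept as failures, because
their values may already have been read and must be in `valsRR`. Running the specification in this
order reproduces all results (`Precede.step`). -/

theorem invokedAt_append {e : Event V} {p i : ℕ} {op : Op V} :
    InvokedAt (h ++ [e]) p i op ↔ InvokedAt h p i op ∨ p = h.length ∧ e = .inv i op := by
  unfold InvokedAt
  rcases lt_trichotomy p h.length with hp | rfl | hp
  · rw [List.getElem?_append_left hp]
    constructor
    · exact Or.inl
    · rintro (h1 | ⟨rfl, -⟩)
      · exact h1
      · exact absurd hp (lt_irrefl _)
  · simp
  · rw [List.getElem?_eq_none (by simp; omega), List.getElem?_eq_none (by omega)]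
    simp; omega

theorem InvokedAt.append {p i : ℕ} {op : Op V} (H : InvokedAt h p i op) (e : Event V) :
    InvokedAt (h ++ [e]) p i op :=
  invokedAt_append.2 (Or.inl H)

theorem InvokedAt.lt {p i : ℕ} {op : Op V} (H : InvokedAt h p i op) : p < h.length := by
  by_contra hp
  simp [InvokedAt, List.getElem?_eq_none (not_lt.1 hp)] at H

theorem InvokedAt.unique {p i i' : ℕ} {op op' : Op V} (H : InvokedAt h p i op)
    (H' : InvokedAt h p i' op') : i = i' ∧ op = op' := by
  unfold InvokedAt at H H'
  rw [H] at H'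
  simpa using H'

theorem RespondedAt.lt {p q i : ℕ} {r : Ret V} (H : RespondedAt h p q i r) : q < h.length := by
  by_contra hp
  simp [RespondedAt, List.getElem?_eq_none (not_lt.1 hp)] at H

theorem RespondedAt.unique {p q q' i : ℕ} {r r' : Ret V} (H : RespondedAt h p q i r)
    (H' : RespondedAt h p q' i r') : q = q' ∧ r = r' := by
  obtain ⟨h1, h2, h3⟩ := H
  obtain ⟨h1', h2', h3'⟩ := H'
  have hq : q = q' := by
    rcases lt_trichotomy q q' with hlt | heq | hlt
    · exact absurd rfl (h3' q _ h1 hlt h2)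
    · exact heq
    · exact absurd rfl (h3 q' _ h1' hlt h2')
  subst hq
  rw [h2] at h2'
  simpa using h2'

/-- The event at position `p` is followed by no event of node `i`. -/
def QuietAfter (h : List (Event V)) (p i : ℕ) : Prop :=
  ∀ m e, p < m → h[m]? = some e → e.node ≠ i

theorem respondedAt_append {e : Event V} {p q i : ℕ} {r : Ret V} :
    RespondedAt (h ++ [e]) p q i r ↔ RespondedAt h p q i r ∨
      q = h.length ∧ e = .res i r ∧ p < h.length ∧ QuietAfter h p i := by
  have key : ∀ m, m < h.length → (h ++ [e])[m]? = h[m]? := fun m hm =>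
    List.getElem?_append_left hm
  rcases lt_trichotomy q h.length with hq | rfl | hq
  · have : RespondedAt (h ++ [e]) p q i r ↔ RespondedAt h p q i r := by
      unfold RespondedAt
      rw [key q hq]
      refine and_congr_right fun _ => and_congr_right fun _ => ?_
      refine forall_congr' fun m => forall_congr' fun e' => forall_congr' fun _ =>
        forall_congr' fun hm => ?_
      rw [key m (hm.trans hq)]
    rw [this]
    constructor
    · exact Or.inl
    · rintro (h1 | ⟨rfl, -⟩)
      · exact h1
      · exact absurd hq (lt_irrefl _)
  · have hno : ¬ RespondedAt h p h.length i r := fun H => lt_irrefl _ H.lt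
    constructor
    · rintro ⟨h1, h2, h3⟩
      refine Or.inr ⟨rfl, by simpa using h2, h1, fun m e' hm he => ?_⟩
      have hlt : m < h.length := by
        by_contra hp
        simp [List.getElem?_eq_none (not_lt.1 hp)] at he
      exact h3 m e' hm hlt (by rw [key m hlt, he])
    · rintro (h1 | ⟨-, rfl, h2, h3⟩)
      · exact absurd h1 hno
      · refine ⟨h2, by simp, fun m e' hm hlt he => ?_⟩
        rw [key m hlt] at he
        exact h3 m e' hm he
  · constructor
    · intro H
      have := H.lt
      simp at this
      omega
    · rintro (h1 | ⟨rfl, -⟩)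
      · exact absurd h1.lt (by omega)
      · exact absurd hq (lt_irrefl _)

theorem RespondedAt.append {p q i : ℕ} {r : Ret V} (H : RespondedAt h p q i r) (e : Event V) :
    RespondedAt (h ++ [e]) p q i r :=
  respondedAt_append.2 (Or.inl H)

theorem QuietAfter.append {p i : ℕ} (H : QuietAfter h p i) {e : Event V} (he : e.node ≠ i) :
    QuietAfter (h ++ [e]) p i := by
  intro m e' hm hm'
  rw [List.getElem?_append] at hm'
  split_ifs at hm' with hlt
  · exact H m e' hm hm'
  · rw [List.getElem?_singleton] at hm'
    split_ifs at hm'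
    simp only [Option.some.injEq] at hm'
    exact hm' ▸ he

/-- The discipline constrains an invocation only through earlier events, so it passes to prefixes.
This permits induction along an execution. -/
theorem RoundDiscipline.of_append {e : Event V} (H : RoundDiscipline (h ++ [e])) :
    RoundDiscipline h where
  readPos p i k h1 := H.readPos p i k (h1.append e)
  readOnce p p' i i' k h1 h2 := H.readOnce p p' i i' k (h1.append e) (h2.append e)
  writeOnce p p' i i' k v v' h1 h2 := H.writeOnce p p' i i' k v v' (h1.append e) (h2.append e)
  readFirst p i k v h1 := by
    obtain ⟨p', q, v', h2, h3, h4, h5⟩ := H.readFirst p i k v (h1.append e)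
    have hp := h1.lt
    refine ⟨p', q, v', ?_, ?_, h4, h5⟩
    · rcases invokedAt_append.1 h2 with h2 | ⟨rfl, -⟩
      · exact h2
      · exact absurd h3.1 (by omega)
    · rcases respondedAt_append.1 h3 with h3 | ⟨rfl, -⟩
      · exact h3
      · omega

/-- Node `i` has invoked `op` and has had no interface event since. -/
def Current (h : List (Event V)) (i : ℕ) (op : Op V) : Prop :=
  ∃ p, InvokedAt h p i op ∧ QuietAfter h p i

theorem Current.append {i : ℕ} {op : Op V} (H : Current h i op) {e : Event V}
    (he : e.node ≠ i) : Current (h ++ [e]) i op :=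
  let ⟨p, h1, h2⟩ := H
  ⟨p, h1.append e, h2.append he⟩

theorem current_append_inv (i : ℕ) (op : Op V) : Current (h ++ [.inv i op]) i op := by
  refine ⟨h.length, invokedAt_append.2 (Or.inr ⟨rfl, rfl⟩), fun m e hm he => ?_⟩
  rw [List.getElem?_eq_none (by simp; omega)] at he
  simp at he

theorem Current.op_eq {p i : ℕ} {op op' : Op V} (H : Current h i op) (h1 : InvokedAt h p i op')
    (h2 : QuietAfter h p i) : op' = op := by
  obtain ⟨p', h1', h2'⟩ := H
  rcases lt_trichotomy p p' with hlt | rfl | hlt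
  · exact absurd rfl (h2 p' _ hlt h1')
  · exact (h1.unique h1').2
  · exact absurd rfl (h2' p _ hlt h1)

/-- `write(k, v)` has been invoked before position `q`. -/
def WrittenBefore (h : List (Event V)) (q k : ℕ) (v : Option V) : Prop :=
  ∃ p i, p < q ∧ InvokedAt h p i (.write k v)

/-- `write(k, v)` has been invoked. -/
def Written (h : List (Event V)) (k : ℕ) (v : Option V) : Prop :=
  ∃ p i, InvokedAt h p i (.write k v)

theorem WrittenBefore.append {q k : ℕ} {v : Option V} (H : WrittenBefore h q k v) (e : Event V) :
    WrittenBefore (h ++ [e]) q k v :=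
  let ⟨p, i, h1, h2⟩ := H
  ⟨p, i, h1, h2.append e⟩

theorem Written.append {k : ℕ} {v : Option V} (H : Written h k v) (e : Event V) :
    Written (h ++ [e]) k v :=
  let ⟨p, i, h2⟩ := H
  ⟨p, i, h2.append e⟩

theorem Written.before {k : ℕ} {v : Option V} (H : Written h k v) :
    WrittenBefore h h.length k v :=
  let ⟨p, i, h2⟩ := H
  ⟨p, i, h2.lt, h2⟩

theorem RoundDiscipline.written_unique (H : RoundDiscipline h) {k : ℕ} {v v' : Option V}
    (h1 : Written h k v) (h2 : Written h k v') : v = v' := by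
  obtain ⟨p, i, h1⟩ := h1
  obtain ⟨p', i', h2⟩ := h2
  obtain rfl := H.writeOnce _ _ _ _ _ _ _ h1 h2
  simpa using (h1.unique h2).2

/-- A write of round `k` presupposes a response to `read(k)`; by `readOnce` that read is the running
one, which has had none. -/
theorem RoundDiscipline.not_written (H : RoundDiscipline h) {i k : ℕ} {v : Option V}
    (h1 : Current h i (.read k)) : ¬ Written h k v := by
  rintro ⟨p, i', h2⟩
  obtain ⟨p0, h3, h4⟩ := h1
  obtain ⟨p', q, v', h5, h6, -, -⟩ := H.readFirst _ _ _ _ h2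
  obtain rfl := H.readOnce _ _ _ _ _ h3 h5
  obtain ⟨rfl, -⟩ := h3.unique h5
  exact absurd rfl (h4 q _ h6.1 h6.2.1)

/-! ### The invariant of the implementation

`AR j k v w` records that acceptor `j` has sent `[ackRE, k, v, w]`, and `AW j k v` that it has
accepted `[WR, k, v]`. -/

variable {AR AR' : ℕ → ℕ → Option V → ℕ → Prop} {AW AW' : ℕ → ℕ → Option V → Prop}

/-- The last clause of `acked` is the promise implicit in an acknowledgement: no acceptance, past or
future, lies strictly between the reported write round and the round of the read. The alternative
with write round `0` and value `none` stands for the initial contents. -/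
structure AccOK (n : ℕ) (h : List (Event V)) (AR : ℕ → ℕ → Option V → ℕ → Prop)
    (AW : ℕ → ℕ → Option V → Prop) (j : ℕ) (a : Acceptor V) : Prop where
  written : ∀ k v, AW j k v → j ∈ Finset.Icc 1 n ∧ k ≤ a.w ∧ Written h k v
  w_le : a.w ≤ a.r
  value : (a.w = 0 ∧ a.v = none) ∨ AW j a.w a.v
  acked : ∀ k v w, AR j k v w → j ∈ Finset.Icc 1 n ∧ k ≤ a.r ∧ w ≤ k ∧
    ((w = 0 ∧ v = none) ∨ AW j w v) ∧ ∀ k' v', w < k' → k' < k → ¬ AW j k' v'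
  job : ∀ i m, a.job = some (i, m) → j ∈ Finset.Icc 1 n ∧ ∀ k v, m = .WR k v → Written h k v

theorem AccOK.append {j : ℕ} {a : Acceptor V} (H : AccOK n h AR AW j a) (e : Event V) :
    AccOK n (h ++ [e]) AR AW j a where
  written k v h1 := let ⟨h2, h3, h4⟩ := H.written k v h1; ⟨h2, h3, h4.append e⟩
  w_le := H.w_le
  value := H.value
  acked := H.acked
  job i m h1 := let ⟨h2, h3⟩ := H.job i m h1; ⟨h2, fun k v h4 => (h3 k v h4).append e⟩

/-- An `ackWR` carries only its round, hence the existential value; uniqueness of the write in a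
round recovers it on receipt. -/
def PacketOK (h : List (Event V)) (AR : ℕ → ℕ → Option V → ℕ → Prop)
    (AW : ℕ → ℕ → Option V → Prop) (x : Packet V) : Prop :=
  match x.msg with
  | .WR k v => Written h k v
  | .ackRE k v w => AR x.src k v w
  | .ackWR k => ∃ v, AW x.src k v
  | _ => True

theorem PacketOK.append {x : Packet V} (H : PacketOK h AR AW x) (e : Event V) :
    PacketOK (h ++ [e]) AR AW x := by
  obtain ⟨i, j, m⟩ := x
  cases m <;> first | exact H | exact Written.append H e

theorem PacketOK.mono {x : Packet V} (H : PacketOK h AR AW x)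
    (hR : ∀ j k v w, AR j k v w → AR' j k v w) (hW : ∀ j k v, AW j k v → AW' j k v) :
    PacketOK h AR' AW' x := by
  obtain ⟨i, j, m⟩ := x
  cases m
  case ackRE => exact hR _ _ _ _ H
  case ackWR => exact H.imp fun v => hW _ _ _
  all_goals exact H

/-- The acknowledgements from `Q` that `read(k)` has treated, with `v` the value of the largest
write round `w` among them. -/
structure ReadAcks (AR : ℕ → ℕ → Option V → ℕ → Prop) (AW : ℕ → ℕ → Option V → Prop)
    (k w : ℕ) (v : Option V) (Q : Finset ℕ) : Prop where
  ack : ∀ j ∈ Q, ∃ vj wj, AR j k vj wj ∧ wj ≤ w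
  value : (w = 0 ∧ v = none) ∨ (w < k ∧ ∃ j, AW j w v)

theorem ReadAcks.mono {k w : ℕ} {v : Option V} {Q : Finset ℕ} (H : ReadAcks AR AW k w v Q)
    (hR : ∀ j k v w, AR j k v w → AR' j k v w) (hW : ∀ j k v, AW j k v → AW' j k v) :
    ReadAcks AR' AW' k w v Q where
  ack j hj := let ⟨vj, wj, h1, h2⟩ := H.ack j hj; ⟨vj, wj, hR _ _ _ _ h1, h2⟩
  value := H.value.imp_right fun ⟨h1, j, h2⟩ => ⟨h1, j, hW _ _ _ h2⟩

def ProposerOK (n : ℕ) (h : List (Event V)) (AR : ℕ → ℕ → Option V → ℕ → Prop)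
    (AW : ℕ → ℕ → Option V → Prop) (i : ℕ) (P : Proposer V) : Prop :=
  match P with
  | .idle => True
  | .readSend k _ => Current h i (.read k)
  | .readLoop k w v Q => Current h i (.read k) ∧ ReadAcks AR AW k w v Q
  | .writeSend k v _ => Current h i (.write k v)
  | .writeLoop k v Q => Current h i (.write k v) ∧ ∀ j ∈ Q, AW j k v
  | .ret (.readOk v) => ∃ k w Q, Current h i (.read k) ∧ ReadAcks AR AW k w v Q ∧
      Q.card = quorum n
  | .ret .readFail => ∃ k, Current h i (.read k)
  | .ret (.wrote b) => ∃ k v, Current h i (.write k v) ∧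
      (b = true → ∃ Q : Finset ℕ, Q.card = quorum n ∧ ∀ j ∈ Q, AW j k v)

theorem ProposerOK.append {i : ℕ} {P : Proposer V} (H : ProposerOK n h AR AW i P) {e : Event V}
    (he : e.node ≠ i) : ProposerOK n (h ++ [e]) AR AW i P := by
  match P, H with
  | .idle, _ => trivial
  | .readSend _ _, H => exact Current.append H he
  | .readLoop _ _ _ _, H => exact ⟨H.1.append he, H.2⟩
  | .writeSend _ _ _, H => exact Current.append H he
  | .writeLoop _ _ _, H => exact ⟨H.1.append he, H.2⟩
  | .ret (.readOk _), ⟨k, w, Q, h1, h2⟩ => exact ⟨k, w, Q, h1.append he, h2⟩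
  | .ret .readFail, ⟨k, h1⟩ => exact ⟨k, h1.append he⟩
  | .ret (.wrote _), ⟨k, v, h1, h2⟩ => exact ⟨k, v, h1.append he, h2⟩

theorem ProposerOK.mono {i : ℕ} {P : Proposer V} (H : ProposerOK n h AR AW i P)
    (hR : ∀ j k v w, AR j k v w → AR' j k v w) (hW : ∀ j k v, AW j k v → AW' j k v) :
    ProposerOK n h AR' AW' i P := by
  match P, H with
  | .idle, _ => trivial
  | .readSend _ _, H => exact H
  | .readLoop _ _ _ _, H => exact ⟨H.1, H.2.mono hR hW⟩
  | .writeSend _ _ _, H => exact H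
  | .writeLoop _ _ _, H => exact ⟨H.1, fun j hj => hW _ _ _ (H.2 j hj)⟩
  | .ret (.readOk _), ⟨k, w, Q, h1, h2, h3⟩ => exact ⟨k, w, Q, h1, h2.mono hR hW, h3⟩
  | .ret .readFail, H => exact H
  | .ret (.wrote _), ⟨k, v, h1, h2⟩ =>
    exact ⟨k, v, h1, fun hb => let ⟨Q, h3, h4⟩ := h2 hb; ⟨Q, h3, fun j hj => hW _ _ _ (h4 j hj)⟩⟩

/-- The acceptors in `Q` have accepted no write of a round below `k` that was invoked after
position `q`. -/
def Barrier (h : List (Event V)) (AW : ℕ → ℕ → Option V → Prop) (q k : ℕ) (Q : Finset ℕ) : Prop :=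
  ∀ j ∈ Q, ∀ k' v', k' < k → AW j k' v' → WrittenBefore h q k' v'

/-- What is known of an operation that has returned at position `q`. -/
def Returned (n : ℕ) (h : List (Event V)) (AR : ℕ → ℕ → Option V → ℕ → Prop)
    (AW : ℕ → ℕ → Option V → Prop) (q : ℕ) (op : Op V) (r : Ret V) : Prop :=
  match op, r with
  | .read k, .readOk v => ∃ w Q, ReadAcks AR AW k w v Q ∧ Q.card = quorum n ∧
      Barrier h AW q k Q ∧ (v = none ∨ WrittenBefore h q w v)
  | .read _, .readFail => True
  | .write k v, .wrote b => b = true → ∃ Q : Finset ℕ, Q.card = quorum n ∧ (∀ j ∈ Q, AW j k v) ∧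
      Barrier h AW q k Q
  | _, _ => False

theorem Barrier.append {q k : ℕ} {Q : Finset ℕ} (H : Barrier h AW q k Q) (e : Event V) :
    Barrier (h ++ [e]) AW q k Q :=
  fun j hj k' v' h1 h2 => (H j hj k' v' h1 h2).append e

theorem Returned.append {q : ℕ} {op : Op V} {r : Ret V} (H : Returned n h AR AW q op r)
    (e : Event V) : Returned n (h ++ [e]) AR AW q op r := by
  match op, r, H with
  | .read _, .readOk _, ⟨w, Q, h1, h2, h3, h4⟩ =>
    exact ⟨w, Q, h1, h2, h3.append e, h4.imp_right fun h5 => h5.append e⟩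
  | .read _, .readFail, _ => trivial
  | .write _ _, .wrote _, H =>
    exact fun hb => let ⟨Q, h1, h2, h3⟩ := H hb; ⟨Q, h1, h2, h3.append e⟩

/-- Barriers are stable because every acceptor of the quorum has reached read round `k`, so by
`hnew` whatever it accepts anew has round at least `k`. -/
theorem Returned.mono {acc : ℕ → Acceptor V} {q : ℕ} {op : Op V} {r : Ret V}
    (H : Returned n h AR AW q op r) (hacc : ∀ j, AccOK n h AR AW j (acc j))
    (hR : ∀ j k v w, AR j k v w → AR' j k v w) (hW : ∀ j k v, AW j k v → AW' j k v)
    (hnew : ∀ j k v, AW' j k v → AW j k v ∨ (acc j).r ≤ k) : Returned n h AR' AW' q op r := by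
  have key : ∀ k Q, (∀ j ∈ Q, k ≤ (acc j).r) → Barrier h AW q k Q → Barrier h AW' q k Q := by
    intro k Q h1 h2 j hj k' v' hk h3
    rcases hnew _ _ _ h3 with h3 | h3
    · exact h2 j hj k' v' hk h3
    · have := h1 j hj
      omega
  match op, r, H with
  | .read _, .readOk _, ⟨w, Q, h1, h2, h3, h4⟩ =>
    refine ⟨w, Q, h1.mono hR hW, h2, key _ _ (fun j hj => ?_) h3, h4⟩
    obtain ⟨vj, wj, h5, -⟩ := h1.ack j hj
    exact ((hacc j).acked _ _ _ h5).2.1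
  | .read _, .readFail, _ => trivial
  | .write _ _, .wrote _, H =>
    intro hb
    obtain ⟨Q, h1, h2, h3⟩ := H hb
    refine ⟨Q, h1, fun j hj => hW _ _ _ (h2 j hj), key _ _ (fun j hj => ?_) h3⟩
    exact ((hacc j).written _ _ (h2 j hj)).2.1.trans (hacc j).w_le

structure Inv (n : ℕ) (h : List (Event V)) (AR : ℕ → ℕ → Option V → ℕ → Prop)
    (AW : ℕ → ℕ → Option V → Prop) (s : State V) : Prop where
  acc : ∀ j, AccOK n h AR AW j (s.acc j)
  prop : ∀ i, ProposerOK n h AR AW i (s.prop i)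
  net : ∀ x ∈ s.net, PacketOK h AR AW x
  returned : ∀ p q i op r, InvokedAt h p i op → RespondedAt h p q i r →
    Returned n h AR AW q op r

/-! ### Preservation of the invariant by the steps of the system -/

theorem forall_update {α : Type*} {p : ℕ → α → Prop} {f : ℕ → α} (hf : ∀ i, p i (f i)) {j : ℕ}
    {a : α} (ha : p j a) (i : ℕ) : p i (Function.update f j a i) := by
  by_cases hij : i = j
  · subst hij
    simpa using ha
  · simpa [Function.update_of_ne hij] using hf i

theorem Inv.init : Inv n [] (fun _ _ _ _ => False) (fun _ _ _ => False) (State.init V) where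
  acc j := ⟨by simp, by simp [State.init], by simp [State.init], by simp, by simp [State.init]⟩
  prop i := trivial
  net x hx := by simp [State.init] at hx
  returned p q i op r h1 := by simp [InvokedAt] at h1

theorem Inv.inv {s : State V} (H : Inv n h AR AW s) {i : ℕ} {op : Op V} {P : Proposer V}
    (hP : ProposerOK n (h ++ [.inv i op]) AR AW i P) :
    Inv n (h ++ [.inv i op]) AR AW { s with prop := Function.update s.prop i P } where
  acc j := (H.acc j).append _
  prop i' := by
    by_cases hij : i' = i
    · subst hij
      simpa using hP
    · simp only [Function.update_of_ne hij]
      exact (H.prop i').append (Ne.symm hij)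
  net x hx := (H.net x hx).append _
  returned p q i' op' r h1 h2 := by
    rcases respondedAt_append.1 h2 with h2 | ⟨-, h2, -⟩
    · rcases invokedAt_append.1 h1 with h1 | ⟨rfl, -⟩
      · exact (H.returned _ _ _ _ _ h1 h2).append _
      · exact absurd (h2.1.trans h2.lt) (lt_irrefl _)
    · simp at h2

/-- At the instant of the response every accepted write has already been invoked, so the barrier
holds trivially; its content lies in its later preservation. -/
theorem Inv.returned_of_ret {s : State V} (H : Inv n h AR AW s) {p i : ℕ} {op : Op V} {r : Ret V}
    (hr : s.prop i = .ret r) (h1 : InvokedAt h p i op) (h2 : QuietAfter h p i) :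
    Returned n h AR AW h.length op r := by
  have hw : ∀ {j k v}, AW j k v → WrittenBefore h h.length k v := fun h3 =>
    ((H.acc _).written _ _ h3).2.2.before
  have hb : ∀ k Q, Barrier h AW h.length k Q := fun k Q j _ k' v' _ h3 => hw h3
  have hP := H.prop i
  rw [hr] at hP
  match r, hP with
  | .readOk v, ⟨k, w, Q, h3, h4, h5⟩ =>
    obtain rfl := h3.op_eq h1 h2
    refine ⟨w, Q, h4, h5, hb _ _, ?_⟩
    rcases h4.value with ⟨-, h6⟩ | ⟨-, j, h6⟩
    · exact Or.inl h6
    · exact Or.inr (hw h6)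
  | .readFail, ⟨k, h3⟩ =>
    obtain rfl := h3.op_eq h1 h2
    trivial
  | .wrote b, ⟨k, v, h3, h4⟩ =>
    obtain rfl := h3.op_eq h1 h2
    intro hb'
    obtain ⟨Q, h5, h6⟩ := h4 hb'
    exact ⟨Q, h5, h6, hb _ _⟩

theorem Inv.res {s : State V} (H : Inv n h AR AW s) {i : ℕ} {r : Ret V}
    (hr : s.prop i = .ret r) :
    Inv n (h ++ [.res i r]) AR AW { s with prop := Function.update s.prop i .idle } where
  acc j := (H.acc j).append _
  prop i' := by
    by_cases hij : i' = i
    · subst hij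
      simp [ProposerOK]
    · simp only [Function.update_of_ne hij]
      exact (H.prop i').append (Ne.symm hij)
  net x hx := (H.net x hx).append _
  returned p q i' op' r' h1 h2 := by
    rcases invokedAt_append.1 h1 with h1 | ⟨-, h1⟩
    · rcases respondedAt_append.1 h2 with h2 | ⟨rfl, h2, -, h3⟩
      · exact (H.returned _ _ _ _ _ h1 h2).append _
      · simp only [Event.res.injEq] at h2
        obtain ⟨rfl, rfl⟩ := h2
        exact (H.returned_of_ret hr h1 h3).append _
    · simp at h1

theorem Inv.proposer {s : State V} (H : Inv n h AR AW s) {i : ℕ} {P : Proposer V}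
    {M : Multiset (Packet V)} (hP : ProposerOK n h AR AW i P)
    (hM : ∀ x ∈ M, PacketOK h AR AW x) :
    Inv n h AR AW { s with prop := Function.update s.prop i P, net := M } where
  acc := H.acc
  prop := forall_update H.prop hP
  net := hM
  returned := H.returned

theorem Inv.acceptor {s : State V} (H : Inv n h AR AW s) {j : ℕ} {a : Acceptor V}
    {M : Multiset (Packet V)}
    (hR : ∀ j k v w, AR j k v w → AR' j k v w) (hW : ∀ j k v, AW j k v → AW' j k v)
    (hnew : ∀ j k v, AW' j k v → AW j k v ∨ (s.acc j).r ≤ k)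
    (hne : ∀ i, i ≠ j → AccOK n h AR' AW' i (s.acc i)) (ha : AccOK n h AR' AW' j a)
    (hM : ∀ x ∈ M, PacketOK h AR' AW' x) :
    Inv n h AR' AW' { s with acc := Function.update s.acc j a, net := M } where
  acc i := by
    by_cases hij : i = j
    · subst hij
      simpa using ha
    · simpa [Function.update_of_ne hij] using hne i hij
  prop i := (H.prop i).mono hR hW
  net := hM
  returned p q i op r h1 h2 := (H.returned p q i op r h1 h2).mono H.acc hR hW hnew

theorem proposerOK_readTest {i k w : ℕ} {v : Option V} {Q : Finset ℕ}
    (h1 : Current h i (.read k)) (h2 : ReadAcks AR AW k w v Q) :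
    ProposerOK n h AR AW i (readTest n k w v Q) := by
  unfold readTest
  split_ifs with h3
  · exact ⟨k, w, Q, h1, h2, h3⟩
  · exact ⟨h1, h2⟩

theorem proposerOK_writeTest {i k : ℕ} {v : Option V} {Q : Finset ℕ}
    (h1 : Current h i (.write k v)) (h2 : ∀ j ∈ Q, AW j k v) :
    ProposerOK n h AR AW i (writeTest n k v Q) := by
  unfold writeTest
  split_ifs with h3
  · exact ⟨k, v, h1, fun _ => ⟨Q, h3, h2⟩⟩
  · exact ⟨h1, h2⟩

theorem proposerOK_readRecv {acc : ℕ → Acceptor V} (hd : RoundDiscipline h)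
    (hacc : ∀ j, AccOK n h AR AW j (acc j)) {i k w j : ℕ} {v : Option V} {Q : Finset ℕ} {m : Msg V}
    (h1 : Current h i (.read k)) (h2 : ReadAcks AR AW k w v Q)
    (hm : PacketOK h AR AW ⟨j, i, m⟩) :
    ProposerOK n h AR AW i (readRecv n k w v Q j m) := by
  match m, hm with
  | .RE _, _ | .WR _ _, _ | .ackWR _, _ | .nackWR _, _ => exact proposerOK_readTest h1 h2
  | .nackRE k', _ =>
    simp only [readRecv]
    split_ifs
    · exact ⟨k, h1⟩
    · exact proposerOK_readTest h1 h2
  | .ackRE k' vj wj, hm =>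
    simp only [readRecv]
    split_ifs with hk hw
    · subst hk
      obtain ⟨-, -, h3, h4, -⟩ := (hacc j).acked _ _ _ hm
      refine proposerOK_readTest h1 ⟨fun j' hj' => ?_, ?_⟩
      · rcases Finset.mem_union.1 hj' with hj' | hj'
        · obtain ⟨v', w', h5, h6⟩ := h2.ack j' hj'
          exact ⟨v', w', h5, h6.trans hw⟩
        · obtain rfl := Finset.mem_singleton.1 hj'
          exact ⟨vj, wj, hm, le_rfl⟩
      · refine h4.imp_right fun h5 => ⟨lt_of_le_of_ne h3 ?_, j, h5⟩
        -- Write round `k` would mean that a write of round `k` was invoked while `read(k)` is still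
        -- running.
        rintro rfl
        exact hd.not_written h1 ((hacc j).written _ _ h5).2.2
    · subst hk
      refine proposerOK_readTest h1 ⟨fun j' hj' => ?_, h2.value⟩
      rcases Finset.mem_union.1 hj' with hj' | hj'
      · exact h2.ack j' hj'
      · obtain rfl := Finset.mem_singleton.1 hj'
        exact ⟨vj, wj, hm, by omega⟩
    · exact proposerOK_readTest h1 h2

theorem proposerOK_writeRecv {acc : ℕ → Acceptor V} (hd : RoundDiscipline h)
    (hacc : ∀ j, AccOK n h AR AW j (acc j)) {i k j : ℕ} {v : Option V} {Q : Finset ℕ} {m : Msg V}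
    (h1 : Current h i (.write k v)) (h2 : ∀ j ∈ Q, AW j k v)
    (hm : PacketOK h AR AW ⟨j, i, m⟩) :
    ProposerOK n h AR AW i (writeRecv n k v Q j m) := by
  match m, hm with
  | .RE _, _ | .WR _ _, _ | .ackRE _ _ _, _ | .nackRE _, _ => exact proposerOK_writeTest h1 h2
  | .nackWR k', _ =>
    simp only [writeRecv]
    split_ifs
    · exact ⟨k, v, h1, by simp⟩
    · exact proposerOK_writeTest h1 h2
  | .ackWR k', hm =>
    simp only [writeRecv]
    split_ifs with hk
    · subst hk
      refine proposerOK_writeTest h1 fun j' hj' => ?_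
      rcases Finset.mem_union.1 hj' with hj' | hj'
      · exact h2 j' hj'
      · obtain rfl := Finset.mem_singleton.1 hj'
        obtain ⟨v', h3⟩ := hm
        obtain ⟨p, h4, -⟩ := h1
        rwa [← hd.written_unique ((hacc _).written _ _ h3).2.2 ⟨p, i, h4⟩]
    · exact proposerOK_writeTest h1 h2

theorem AccOK.clear {j : ℕ} {a : Acceptor V} (H : AccOK n h AR AW j a) :
    AccOK n h AR AW j ⟨a.v, a.r, a.w, none⟩ :=
  ⟨H.written, H.w_le, H.value, H.acked, by simp⟩

theorem Inv.handle {s : State V} (H : Inv n h AR AW s) {i j : ℕ} {m : Msg V}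
    (hj : (s.acc j).job = some (i, m)) :
    ∃ AR' AW', Inv n h AR' AW'
      { s with
        acc := Function.update s.acc j ((s.acc j).handle m).1
        net := match ((s.acc j).handle m).2 with
          | some reply => ⟨j, i, reply⟩ ::ₘ s.net
          | none => s.net } := by
  have hA := H.acc j
  obtain ⟨hmem, hm⟩ := hA.job i m hj
  -- Refused and skipped messages only clear the job, so the ghost relations stay as they are.
  have same : ∀ M : Multiset (Packet V), (∀ x ∈ M, PacketOK h AR AW x) → ∃ AR' AW', Inv n h AR' AW'
      { s with
        acc := Function.update s.acc j ⟨(s.acc j).v, (s.acc j).r, (s.acc j).w, none⟩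
        net := M } := fun M hM =>
    ⟨AR, AW, H.acceptor (fun _ _ _ _ => id) (fun _ _ _ => id) (fun _ _ _ => Or.inl)
      (fun i _ => H.acc i) hA.clear hM⟩
  match m, hm with
  | .ackRE _ _ _, _ | .nackRE _, _ | .ackWR _, _ | .nackWR _, _ => exact same _ H.net
  | .RE k, _ =>
    by_cases hk : k < (s.acc j).r
    · simp only [Acceptor.handle, if_pos hk]
      refine same _ fun x hx => ?_
      rcases Multiset.mem_cons.1 hx with rfl | hx
      · trivial
      · exact H.net x hx
    · simp only [Acceptor.handle, if_neg hk]
      have hk' := not_lt.1 hk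
      refine ⟨fun j' k' v' w' => AR j' k' v' w' ∨
        j' = j ∧ k' = k ∧ v' = (s.acc j).v ∧ w' = (s.acc j).w, AW,
        H.acceptor (fun _ _ _ _ => Or.inl) (fun _ _ _ => id) (fun _ _ _ => Or.inl) ?_ ?_ ?_⟩
      · intro i' hi'
        refine ⟨(H.acc i').written, (H.acc i').w_le, (H.acc i').value, ?_, (H.acc i').job⟩
        rintro k' v' w' (h1 | ⟨h1, -⟩)
        · exact (H.acc i').acked _ _ _ h1
        · exact absurd h1 hi'
      · refine ⟨hA.written, hA.w_le.trans hk', hA.value, ?_, by simp⟩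
        rintro k' v' w' (h1 | ⟨-, rfl, rfl, rfl⟩)
        · obtain ⟨h2, h3, h4⟩ := hA.acked _ _ _ h1
          exact ⟨h2, h3.trans hk', h4⟩
        · refine ⟨hmem, le_rfl, hA.w_le.trans hk', hA.value, fun k'' v'' h1 _ h2 => ?_⟩
          -- When the acknowledgement is sent, no accepted round exceeds the reported write round,
          -- so the gap is empty.
          have := (hA.written _ _ h2).2.1
          omega
      · intro x hx
        rcases Multiset.mem_cons.1 hx with rfl | hx
        · exact Or.inr ⟨rfl, rfl, rfl, rfl⟩
        · exact (H.net x hx).mono (fun _ _ _ _ => Or.inl) (fun _ _ _ => id)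
  | .WR k v, hm =>
    by_cases hk : k < (s.acc j).r
    · simp only [Acceptor.handle, if_pos hk]
      refine same _ fun x hx => ?_
      rcases Multiset.mem_cons.1 hx with rfl | hx
      · trivial
      · exact H.net x hx
    · simp only [Acceptor.handle, if_neg hk]
      have hk' := not_lt.1 hk
      refine ⟨AR, fun j' k' v' => AW j' k' v' ∨ j' = j ∧ k' = k ∧ v' = v,
        H.acceptor (fun _ _ _ _ => id) (fun _ _ _ => Or.inl) ?_ ?_ ?_ ?_⟩
      · rintro j' k' v' (h1 | ⟨rfl, rfl, rfl⟩)
        · exact Or.inl h1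
        · exact Or.inr hk'
      · intro i' hi'
        have hB := H.acc i'
        refine ⟨?_, hB.w_le, hB.value.imp_right Or.inl, ?_, hB.job⟩
        · rintro k' v' (h1 | ⟨h1, -⟩)
          · exact hB.written _ _ h1
          · exact absurd h1 hi'
        · intro k' v' w' h1
          obtain ⟨h2, h3, h4, h5, h6⟩ := hB.acked _ _ _ h1
          refine ⟨h2, h3, h4, h5.imp_right Or.inl, fun k'' v'' h7 h8 h9 => ?_⟩
          rcases h9 with h9 | ⟨h9, -⟩
          · exact h6 _ _ h7 h8 h9
          · exact hi' h9
      · refine ⟨?_, le_rfl, Or.inr (Or.inr ⟨rfl, rfl, rfl⟩), ?_, by simp⟩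
        · rintro k' v' (h1 | ⟨-, rfl, rfl⟩)
          · obtain ⟨h2, h3, h4⟩ := hA.written _ _ h1
            exact ⟨h2, (h3.trans hA.w_le).trans hk', h4⟩
          · exact ⟨hmem, le_rfl, hm _ _ rfl⟩
        · intro k' v' w' h1
          obtain ⟨h2, h3, h4, h5, h6⟩ := hA.acked _ _ _ h1
          refine ⟨h2, h3.trans hk', h4, h5.imp_right Or.inl, fun k'' v'' h7 h8 h9 => ?_⟩
          -- The newly accepted round is at least the read round, hence at least every acknowledged
          -- round, and cannot fall into an old gap.
          rcases h9 with h9 | ⟨-, rfl, -⟩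
          · exact h6 _ _ h7 h8 h9
          · omega
      · intro x hx
        rcases Multiset.mem_cons.1 hx with rfl | hx
        · exact ⟨v, Or.inr ⟨rfl, rfl, rfl⟩⟩
        · exact (H.net x hx).mono (fun _ _ _ _ => id) (fun _ _ _ => Or.inl)

theorem Inv.silent {s s' : State V} (hd : RoundDiscipline h) (H : Inv n h AR AW s)
    (hs : Step n s none s') : ∃ AR' AW', Inv n h AR' AW' s' := by
  cases hs with
  | sendRead i k j hp hj =>
    have hP := H.prop i
    rw [hp] at hP
    refine ⟨AR, AW, H.proposer hP fun x hx => ?_⟩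
    rcases Multiset.mem_cons.1 hx with rfl | hx
    · trivial
    · exact H.net x hx
  | sentRead i k j hp hj =>
    have hP := H.prop i
    rw [hp] at hP
    exact ⟨AR, AW, H.proposer ⟨hP, by simp, Or.inl ⟨rfl, rfl⟩⟩ H.net⟩
  | sendWrite i k v j hp hj =>
    have hP := H.prop i
    rw [hp] at hP
    refine ⟨AR, AW, H.proposer hP fun x hx => ?_⟩
    rcases Multiset.mem_cons.1 hx with rfl | hx
    · obtain ⟨p, h1, -⟩ := hP
      exact ⟨p, i, h1⟩
    · exact H.net x hx
  | sentWrite i k v j hp hj =>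
    have hP := H.prop i
    rw [hp] at hP
    exact ⟨AR, AW, H.proposer ⟨hP, by simp⟩ H.net⟩
  | recvRead i k w v Q j m M hp hM =>
    have hP := H.prop i
    rw [hp] at hP
    have hN := H.net
    rw [hM] at hN
    exact ⟨AR, AW, H.proposer
      (proposerOK_readRecv hd H.acc hP.1 hP.2 (hN _ (Multiset.mem_cons_self _ _)))
      fun x hx => hN x (Multiset.mem_cons_of_mem hx)⟩
  | recvWrite i k v Q j m M hp hM =>
    have hP := H.prop i
    rw [hp] at hP
    have hN := H.net
    rw [hM] at hN
    exact ⟨AR, AW, H.proposer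
      (proposerOK_writeRecv hd H.acc hP.1 hP.2 (hN _ (Multiset.mem_cons_self _ _)))
      fun x hx => hN x (Multiset.mem_cons_of_mem hx)⟩
  | accRecv i j m M hj hjob hM =>
    have hN := H.net
    rw [hM] at hN
    have hA := H.acc j
    refine ⟨AR, AW, H.acceptor (fun _ _ _ _ => id) (fun _ _ _ => id) (fun _ _ _ => Or.inl)
      (fun i _ => H.acc i) ⟨hA.written, hA.w_le, hA.value, hA.acked, ?_⟩
      fun x hx => hN x (Multiset.mem_cons_of_mem hx)⟩
    intro i' m' h1
    simp only [Option.some.injEq, Prod.mk.injEq] at h1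
    obtain ⟨rfl, rfl⟩ := h1
    refine ⟨hj, ?_⟩
    rintro k v rfl
    exact hN _ (Multiset.mem_cons_self _ _)
  | accHandle i j m hj => exact H.handle hj

theorem Inv.visible {s s' : State V} {e : Event V} (H : Inv n h AR AW s)
    (hs : Step n s (some e) s') : Inv n (h ++ [e]) AR AW s' := by
  cases hs with
  | callRead i k => exact H.inv (current_append_inv _ _)
  | callWrite i k v => exact H.inv (current_append_inv _ _)
  | doReturn i r hr => exact H.res hr

theorem Exec.exists_inv {s : State V} (he : Exec n h s) (hd : RoundDiscipline h) :
    ∃ AR AW, Inv n h AR AW s := by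
  induction he with
  | init => exact ⟨_, _, Inv.init⟩
  | silent _ hs ih =>
    obtain ⟨AR, AW, H⟩ := ih hd
    exact H.silent hd hs
  | visible _ hs ih =>
    obtain ⟨AR, AW, H⟩ := ih hd.of_append
    exact ⟨AR, AW, H.visible hs⟩

/-- The conditions that the interface imposes on an operation `op` invoked by node `i`. -/
def Admissible (n i : ℕ) (op : Op V) : Prop :=
  match op with
  | .read k => i = owner n k
  | .write k v => v ≠ none ∧ i = owner n k

theorem Exec.admissible {s : State V} (he : Exec n h s) :
    ∀ {p i op}, InvokedAt h p i op → Admissible n i op := by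
  induction he with
  | init => simp [InvokedAt]
  | silent _ _ ih => exact ih
  | visible _ hs ih =>
    intro p i op h1
    rcases invokedAt_append.1 h1 with h1 | ⟨-, rfl⟩
    · exact ih h1
    · cases hs with
      | callRead _ _ _ _ h2 => exact h2
      | callWrite _ _ _ _ _ h2 h3 => exact ⟨h2, h3⟩

/-! ### Consequences for completed operations -/

/-- Twice the quorum is at least `n + 1`, too many for disjoint subsets of `n` nodes. -/
theorem quorum_inter {Q Q' : Finset ℕ} (hQ : Q ⊆ Finset.Icc 1 n) (hQ' : Q' ⊆ Finset.Icc 1 n)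
    (h1 : Q.card = quorum n) (h2 : Q'.card = quorum n) : ∃ j ∈ Q, j ∈ Q' := by
  by_contra hno
  push Not at hno
  have hdis : Disjoint Q Q' := Finset.disjoint_left.2 hno
  have h3 := Finset.card_le_card (Finset.union_subset hQ hQ')
  rw [Finset.card_union_of_disjoint hdis, h1, h2, Nat.card_Icc] at h3
  have h4 : ((n : ℚ) + 1) / 2 ≤ quorum n := Nat.le_ceil _
  have h5 : ((quorum n + quorum n : ℕ) : ℚ) ≤ n := by exact_mod_cast (by omega)
  push_cast at h5
  linarith

/-- The operation `op` invoked at position `p` has returned `r` at position `q`. -/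
def Completed (h : List (Event V)) (p q : ℕ) (op : Op V) (r : Ret V) : Prop :=
  ∃ i, InvokedAt h p i op ∧ RespondedAt h p q i r

variable {s : State V}

theorem Inv.write_quorum (H : Inv n h AR AW s) {p q k : ℕ} {v : Option V}
    (hc : Completed h p q (.write k v) (.wrote true)) :
    ∃ Q ⊆ Finset.Icc 1 n, Q.card = quorum n ∧ (∀ j ∈ Q, AW j k v) ∧ Barrier h AW q k Q := by
  obtain ⟨i, h1, h2⟩ := hc
  obtain ⟨Q, h3, h4, h5⟩ := H.returned _ _ _ _ _ h1 h2 rfl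
  exact ⟨Q, fun j hj => ((H.acc j).written _ _ (h4 j hj)).1, h3, h4, h5⟩

theorem Inv.read_quorum (H : Inv n h AR AW s) {p q k : ℕ} {v : Option V}
    (hc : Completed h p q (.read k) (.readOk v)) :
    ∃ w, ∃ Q ⊆ Finset.Icc 1 n, Q.card = quorum n ∧ ReadAcks AR AW k w v Q ∧ Barrier h AW q k Q ∧
      (v = none ∨ WrittenBefore h q w v) := by
  obtain ⟨i, h1, h2⟩ := hc
  obtain ⟨w, Q, h3, h4, h5, h6⟩ := H.returned _ _ _ _ _ h1 h2
  refine ⟨w, Q, fun j hj => ?_, h4, h3, h5, h6⟩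
  obtain ⟨vj, wj, h7, -⟩ := h3.ack j hj
  exact ((H.acc j).acked _ _ _ h7).1

/-- An acceptor common to both quorums has accepted the write of round `k`; the barrier at round
`k'` dates the invocation of that write before `q'`. -/
theorem Inv.invoked_lt (H : Inv n h AR AW s) (hd : RoundDiscipline h) {p q q' k k' : ℕ}
    {v : Option V} (hc : Completed h p q (.write k v) (.wrote true)) (hk : k < k') {Q : Finset ℕ}
    (hQ : Q ⊆ Finset.Icc 1 n) (hcard : Q.card = quorum n) (hb : Barrier h AW q' k' Q) :
    p < q' := by
  obtain ⟨Q', h1, h2, h3, -⟩ := H.write_quorum hc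
  obtain ⟨j, hj, hj'⟩ := quorum_inter hQ h1 hcard h2
  obtain ⟨p', i', h4, h5⟩ := hb j hj k v hk (h3 j hj')
  obtain ⟨i, h6, -⟩ := hc
  rwa [hd.writeOnce _ _ _ _ _ _ _ h6 h5]

/-- The facts about completed operations from which a linearisation is built. -/
structure Coherent (n : ℕ) (h : List (Event V)) : Prop where
  admissible : ∀ p i op, InvokedAt h p i op → Admissible n i op
  result : ∀ p q op r, Completed h p q op r →
    match op with
    | .read _ => r = .readFail ∨ ∃ v, r = .readOk v
    | .write _ _ => ∃ b, r = .wrote b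
  write_lt_write : ∀ p q k v p' q' k' v', Completed h p q (.write k v) (.wrote true) →
    Completed h p' q' (.write k' v') (.wrote true) → k < k' → p < q'
  write_lt_read : ∀ p q k v p' q' k' v', Completed h p q (.write k v) (.wrote true) →
    Completed h p' q' (.read k') (.readOk v') → k < k' → p < q'
  read_eq : ∀ k' p q k v p' q' v', Completed h p q (.write k v) (.wrote true) →
    Completed h p' q' (.read k') (.readOk v') → k < k' → v' = v
  read_written : ∀ p q k v, Completed h p q (.read k) (.readOk v) →
    v = none ∨ ∃ k' < k, WrittenBefore h q k' v

theorem Exec.coherent (he : Exec n h s) (hd : RoundDiscipline h) : Coherent n h := by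
  obtain ⟨AR, AW, H⟩ := he.exists_inv hd
  constructor
  · intro p i op
    exact he.admissible
  · rintro p q op r ⟨i, h1, h2⟩
    have h3 := H.returned _ _ _ _ _ h1 h2
    match op, r, h3 with
    | .read _, .readOk v, _ => exact Or.inr ⟨v, rfl⟩
    | .read _, .readFail, _ => exact Or.inl rfl
    | .write _ _, .wrote b, _ => exact ⟨b, rfl⟩
  · intro p q k v p' q' k' v' h1 h2 hk
    obtain ⟨Q, h3, h4, -, h5⟩ := H.write_quorum h2
    exact H.invoked_lt hd h1 hk h3 h4 h5
  · intro p q k v p' q' k' v' h1 h2 hk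
    obtain ⟨w, Q, h3, h4, -, h5, -⟩ := H.read_quorum h2
    exact H.invoked_lt hd h1 hk h3 h4 h5
  · intro k'
    induction k' using Nat.strong_induction_on with
    | _ k' ih =>
      intro p q k v p' q' v' h1 h2 hk
      obtain ⟨Q, h3, h4, h5, -⟩ := H.write_quorum h1
      obtain ⟨w, Q', h6, h7, h8, -, -⟩ := H.read_quorum h2
      obtain ⟨j, hj, hj'⟩ := quorum_inter h3 h6 h4 h7
      obtain ⟨vj, wj, h9, h10⟩ := h8.ack j hj'
      -- The common acceptor reported `wj ≤ w`; were `w < k`, its acceptance of round `k` would lie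
      -- in the forbidden gap between `wj` and `k'`.
      have hkw : k ≤ w := by
        by_contra hlt
        exact ((H.acc j).acked _ _ _ h9).2.2.2.2 k v (by omega) hk (h5 j hj)
      have hinv : ∃ i, InvokedAt h p i (.write k v) := h1.imp fun i => And.left
      -- Positivity rules out that the write round `0` of the initial contents counts as at least
      -- `k`.
      have hpos : 1 ≤ k := by
        obtain ⟨i, h11⟩ := hinv
        obtain ⟨p0, q0, v0, h12, -⟩ := hd.readFirst _ _ _ _ h11
        exact hd.readPos _ _ _ h12
      rcases h8.value with ⟨h11, -⟩ | ⟨h11, j', h12⟩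
      · omega
      · have hw := ((H.acc j').written _ _ h12).2.2
        rcases hkw.eq_or_lt with rfl | hlt
        · exact hd.written_unique hw ⟨p, hinv⟩
        · obtain ⟨p1, i1, h13⟩ := hw
          -- The write of round `w` was preceded by a successful `read(w)` with `k < w < k'`. By
          -- induction that read returned `v`, which is not `undef`, so the caller had to write `v`
          -- again.
          obtain ⟨p0, q0, v0, h14, h15, -, h16⟩ := hd.readFirst _ _ _ _ h13
          have h17 := ih w h11 _ _ _ _ _ _ _ h1 ⟨i1, h14, h15⟩ hlt
          obtain ⟨i, h18⟩ := hinv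
          have h19 : v ≠ none := (he.admissible h18).1
          rcases h16 with h16 | h16
          · exact absurd (h17.symm.trans h16) h19
          · exact h16.trans h17
  · intro p q k v h1
    obtain ⟨w, Q, -, -, h2, -, h3⟩ := H.read_quorum h1
    rcases h2.value with ⟨-, h4⟩ | ⟨h4, -⟩
    · exact Or.inl h4
    · exact h3.imp_right fun h5 => ⟨w, h4, h5⟩

/-! ### Construction of the linearisation -/

/-- The records that are linearised: completed operations with their results, and pending writes,
which are taken to fail. -/
def Recorded (h : List (Event V)) (x : OpRec V) : Prop :=
  InvokedAt h x.pos x.node x.op ∧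
    ((∃ q, RespondedAt h x.pos q x.node x.ret) ∨
      (¬ ∃ q r, RespondedAt h x.pos q x.node r) ∧ (∃ k v, x.op = .write k v) ∧
        x.ret = .wrote false)

theorem Recorded.eq_of_pos_eq {x y : OpRec V} (hx : Recorded h x) (hy : Recorded h y)
    (hxy : x.pos = y.pos) : x = y := by
  obtain ⟨p, i, op, r⟩ := x
  obtain ⟨p', i', op', r'⟩ := y
  simp only [Recorded] at hx hy hxy
  subst hxy
  obtain ⟨h1, h2⟩ := hx
  obtain ⟨h3, h4⟩ := hy
  obtain ⟨rfl, rfl⟩ := h1.unique h3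
  have : r = r' := by
    rcases h2 with ⟨q, h2⟩ | ⟨h2, -, h5⟩ <;> rcases h4 with ⟨q', h4⟩ | ⟨h4, -, h6⟩
    · exact (h2.unique h4).2
    · exact absurd ⟨_, _, h2⟩ h4
    · exact absurd ⟨_, _, h4⟩ h2
    · exact h5.trans h6.symm
  rw [this]

theorem Recorded.completed {x : OpRec V} (hx : Recorded h x) (hr : x.ret ≠ .wrote false) :
    ∃ q, Completed h x.pos q x.op x.ret := by
  obtain ⟨h1, ⟨q, h2⟩ | ⟨-, -, h3⟩⟩ := hx
  · exact ⟨q, x.node, h1, h2⟩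
  · exact absurd h3 hr

theorem finite_recorded (h : List (Event V)) : {x | Recorded h x}.Finite := by
  refine Set.Finite.of_finite_image ((Set.finite_Iio h.length).subset ?_)
    (f := OpRec.pos) fun x hx y hy hxy => Recorded.eq_of_pos_eq hx hy hxy
  rintro _ ⟨x, hx, rfl⟩
  exact hx.1.lt

/-- `t` is the position at which `x` is linearised: a read at its response, a successful write at
the latest invocation of a successful write of the same or a lower round, and any other write at
its invocation. -/
def TakesEffectAt (h : List (Event V)) (x : OpRec V) (t : ℕ) : Prop :=
  match x.op, x.ret with
  | .read _, _ => RespondedAt h x.pos t x.node x.ret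
  | .write k _, .wrote true =>
      (∃ q k' v', k' ≤ k ∧ Completed h t q (.write k' v') (.wrote true)) ∧
        ∀ p q k' v', k' ≤ k → Completed h p q (.write k' v') (.wrote true) → p ≤ t
  | .write _ _, _ => t = x.pos

theorem Completed.pos_lt {p q : ℕ} {op : Op V} {r : Ret V} (H : Completed h p q op r) :
    p < h.length :=
  let ⟨_, h1, _⟩ := H
  h1.lt

/-- For a successful write the candidate points are bounded by the length of the history and include
its own invocation, so a greatest one exists. -/
theorem Recorded.exists_takesEffectAt {x : OpRec V} (hx : Recorded h x) :
    ∃ t, TakesEffectAt h x t := by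
  classical
  obtain ⟨p, i, op, r⟩ := x
  match op, r, hx with
  | .read _, _, ⟨_, Or.inl ⟨q, h2⟩⟩ => exact ⟨q, h2⟩
  | .read _, _, ⟨_, Or.inr ⟨_, ⟨_, _, h2⟩, _⟩⟩ => simp at h2
  | .write k v, .wrote true, hx =>
    obtain ⟨q, hq⟩ := hx.completed (by simp)
    let S : ℕ → Prop := fun p => ∃ q k' v', k' ≤ k ∧
      Completed h p q (.write k' v') (.wrote true)
    have hp : S p := ⟨q, k, v, le_rfl, hq⟩
    refine ⟨Nat.findGreatest S h.length, Nat.findGreatest_spec hq.pos_lt.le hp, ?_⟩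
    intro p' q' k' v' hk hc
    exact Nat.le_findGreatest hc.pos_lt.le ⟨q', k', v', hk, hc⟩
  | .write k v, .wrote false, _ | .write k v, .readOk _, _ | .write k v, .readFail, _ =>
    exact ⟨p, rfl⟩

theorem Recorded.cases (H : Coherent n h) {x : OpRec V} (hx : Recorded h x) :
    (∃ k, x.op = .read k ∧ (x.ret = .readFail ∨ ∃ v, x.ret = .readOk v)) ∨
      ∃ k v b, x.op = .write k v ∧ x.ret = .wrote b := by
  obtain ⟨p, i, op, r⟩ := x
  obtain ⟨h1, ⟨q, h2⟩ | ⟨-, ⟨k, v, h3⟩, h4⟩⟩ := hx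
  · have h3 := H.result _ _ _ _ ⟨_, h1, h2⟩
    match op, h3 with
    | .read k, h3 => exact Or.inl ⟨k, rfl, h3⟩
    | .write k v, ⟨b, h3⟩ => exact Or.inr ⟨k, v, b, rfl, h3⟩
  · exact Or.inr ⟨k, v, false, h3, h4⟩

theorem TakesEffectAt.pos_le {x : OpRec V} {t : ℕ} (hx : Recorded h x)
    (ht : TakesEffectAt h x t) : x.pos ≤ t := by
  obtain ⟨p, i, op, r⟩ := x
  match op, r, ht with
  | .read k, r, ht => exact (show RespondedAt h p t i r from ht).1.le
  | .write k v, .wrote true, ht =>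
    obtain ⟨q, hq⟩ := hx.completed (by simp)
    exact ht.2 _ _ _ _ le_rfl hq
  | .write k v, .wrote false, ht | .write k v, .readOk _, ht | .write k v, .readFail, ht =>
    exact (show t = p from ht).ge

/-- Only the delayed point of a successful write needs an argument: it is its own invocation or that
of a successful write of a lower round, which `write_lt_write` puts before this response. -/
theorem TakesEffectAt.le_response (H : Coherent n h) (hd : RoundDiscipline h) {x : OpRec V}
    {t q : ℕ} {r : Ret V} (hx : Recorded h x) (ht : TakesEffectAt h x t)
    (hq : RespondedAt h x.pos q x.node r) : t ≤ q := by
  obtain ⟨p, i, op, r'⟩ := x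
  match op, r', ht with
  | .read k, r', ht => exact (ht.unique hq).1.le
  | .write k v, .wrote true, ht =>
    obtain ⟨q1, i1, h1, h2⟩ := hx.completed (by simp)
    obtain ⟨rfl, -⟩ := h1.unique hx.1
    obtain ⟨rfl, rfl⟩ := h2.unique hq
    obtain ⟨q2, k', v', hk, hc⟩ := ht.1
    rcases hk.eq_or_lt with rfl | hk
    · obtain ⟨i2, h3, -⟩ := hc
      rw [hd.writeOnce _ _ _ _ _ _ _ h3 h1]
      exact h2.1.le
    · exact (H.write_lt_write _ _ _ _ _ _ _ _ hc ⟨_, h1, h2⟩ hk).le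
  | .write k v, .wrote false, ht | .write k v, .readOk _, ht | .write k v, .readFail, ht =>
    exact (show t = p from ht).trans_le hq.1.le

def Op.round : Op V → ℕ
  | .read k => k
  | .write k _ => k

/-- The abstract state reached after the operations of `P`. -/
structure Reaches (P : List (OpRec V)) (s : SpecState V) : Prop where
  vals : ∀ v, v ∈ s.valsRR ↔ v = none ∨ ∃ x ∈ P, ∃ k, x.op = .write k v
  write_le : ∀ x ∈ P, ∀ k v, x.op = .write k v → x.ret = .wrote true → k ≤ s.roundRR
  round : s.roundRR = 0 ∨ ∃ x ∈ P, x.op.round = s.roundRR ∧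
    ((∃ v, x.ret = .readOk v) ∨ x.ret = .wrote true)
  value : s.vRR = none ∨ ∃ x ∈ P, ∃ k, x.op = .write k s.vRR ∧ x.ret = .wrote true

theorem reaches_init : Reaches [] (SpecState.init V) where
  vals v := by simp [SpecState.init]
  write_le := by simp
  round := Or.inl rfl
  value := Or.inl rfl

/-! ### Running the specification along the order of linearisation -/

section Order

variable {T : OpRec V → ℕ} {P : List (OpRec V)} {x : OpRec V}

/-- `P` lists the recorded operations that precede `x` in the order of linearisation. -/
structure Precede (h : List (Event V)) (T : OpRec V → ℕ) (P : List (OpRec V)) (x : OpRec V) :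
    Prop where
  recorded : ∀ y ∈ P, Recorded h y
  le : ∀ y ∈ P, T y < T x ∨ T y = T x ∧ y.op.round ≤ x.op.round
  mem : ∀ y, Recorded h y → T y < T x → y ∈ P

theorem step_readFail {s : SpecState V} {i k p : ℕ} (ha : i = owner n k) (hs : Reaches P s) :
    SpecStep n i (.read k) s .readFail s ∧ Reaches (P ++ [⟨p, i, .read k, .readFail⟩]) s := by
  refine ⟨⟨none, false, (hs.vals _).2 (Or.inl rfl), ha, by simp [specReadBody]⟩, ?_, ?_, ?_, ?_⟩
  · intro v
    rw [hs.vals v]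
    simp
  · intro y hy k' v' h1 h2
    rcases List.mem_append.1 hy with hy | hy
    · exact hs.write_le y hy _ _ h1 h2
    · obtain rfl := List.mem_singleton.1 hy
      simp at h1
  · exact hs.round.imp_right fun ⟨y, hy, h1⟩ => ⟨y, List.mem_append_left _ hy, h1⟩
  · exact hs.value.imp_right fun ⟨y, hy, h1⟩ => ⟨y, List.mem_append_left _ hy, h1⟩

theorem step_wroteFalse {s : SpecState V} {i k p : ℕ} {v : Option V} (hv : v ≠ none)
    (ha : i = owner n k) (hs : Reaches P s) :
    ∃ s', SpecStep n i (.write k v) s (.wrote false) s' ∧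
      Reaches (P ++ [⟨p, i, .write k v, .wrote false⟩]) s' := by
  refine ⟨{ s with valsRR := s.valsRR ∪ {v} }, ⟨false, hv, ha, by simp [specWriteBody]⟩,
    ?_, ?_, ?_, ?_⟩
  · intro v'
    simp only [Set.mem_union, hs.vals v', Set.mem_singleton_iff, List.mem_append,
      List.mem_singleton]
    constructor
    · rintro ((rfl | ⟨y, hy, k', h1⟩) | rfl)
      · exact Or.inl rfl
      · exact Or.inr ⟨y, Or.inl hy, k', h1⟩
      · exact Or.inr ⟨_, Or.inr rfl, k, rfl⟩
    · rintro (rfl | ⟨y, hy | rfl, k', h1⟩)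
      · exact Or.inl (Or.inl rfl)
      · exact Or.inl (Or.inr ⟨y, hy, k', h1⟩)
      · simp only [Op.write.injEq] at h1
        exact Or.inr h1.2.symm
  · intro y hy k' v' h1 h2
    rcases List.mem_append.1 hy with hy | hy
    · exact hs.write_le y hy _ _ h1 h2
    · obtain rfl := List.mem_singleton.1 hy
      simp at h2
  · exact hs.round.imp_right fun ⟨y, hy, h1⟩ => ⟨y, List.mem_append_left _ hy, h1⟩
  · exact hs.value.imp_right fun ⟨y, hy, h1⟩ => ⟨y, List.mem_append_left _ hy, h1⟩

theorem step_wroteTrue {s : SpecState V} {i k p : ℕ} {v : Option V} (hv : v ≠ none)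
    (ha : i = owner n k) (hs : Reaches P s) (hk : s.roundRR ≤ k) :
    ∃ s', SpecStep n i (.write k v) s (.wrote true) s' ∧
      Reaches (P ++ [⟨p, i, .write k v, .wrote true⟩]) s' := by
  refine ⟨⟨v, k, s.valsRR ∪ {v}⟩, ⟨true, hv, ha, by simp [specWriteBody, hk]⟩,
    ?_, ?_, ?_, ?_⟩
  · intro v'
    simp only [Set.mem_union, hs.vals v', Set.mem_singleton_iff, List.mem_append,
      List.mem_singleton]
    constructor
    · rintro ((rfl | ⟨y, hy, k', h1⟩) | rfl)
      · exact Or.inl rfl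
      · exact Or.inr ⟨y, Or.inl hy, k', h1⟩
      · exact Or.inr ⟨_, Or.inr rfl, k, rfl⟩
    · rintro (rfl | ⟨y, hy | rfl, k', h1⟩)
      · exact Or.inl (Or.inl rfl)
      · exact Or.inl (Or.inr ⟨y, hy, k', h1⟩)
      · simp only [Op.write.injEq] at h1
        exact Or.inr h1.2.symm
  · intro y hy k' v' h1 h2
    rcases List.mem_append.1 hy with hy | hy
    · exact (hs.write_le y hy _ _ h1 h2).trans hk
    · obtain rfl := List.mem_singleton.1 hy
      simp only [Op.write.injEq] at h1
      exact h1.1.ge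
  · exact Or.inr ⟨_, List.mem_append_right _ (List.mem_singleton.2 rfl), rfl, Or.inr rfl⟩
  · exact Or.inr ⟨_, List.mem_append_right _ (List.mem_singleton.2 rfl), k, rfl, rfl⟩

theorem step_readOk {s : SpecState V} {i k p : ℕ} {v : Option V}
    (ha : i = owner n k) (hs : Reaches P s) (hv : v ∈ s.valsRR)
    (heq : s.roundRR ≤ k → s.vRR ≠ none → v = s.vRR) :
    ∃ s', SpecStep n i (.read k) s (.readOk v) s' ∧
      Reaches (P ++ [⟨p, i, .read k, .readOk v⟩]) s' := by
  have hvals : ∀ v', v' ∈ s.valsRR ↔ v' = none ∨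
      ∃ x ∈ P ++ [⟨p, i, .read k, .readOk v⟩], ∃ k, x.op = .write k v' := by
    intro v'
    rw [hs.vals v']
    simp
  have hvalue : s.vRR = none ∨ ∃ x ∈ P ++ [⟨p, i, .read k, .readOk v⟩], ∃ k,
      x.op = .write k s.vRR ∧ x.ret = .wrote true :=
    hs.value.imp_right fun ⟨y, hy, h1⟩ => ⟨y, List.mem_append_left _ hy, h1⟩
  have hle : ∀ x ∈ P ++ [⟨p, i, .read k, .readOk v⟩], ∀ k v, x.op = .write k v →
      x.ret = .wrote true → k ≤ s.roundRR := by
    intro y hy k' v' h1 h2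
    rcases List.mem_append.1 hy with hy | hy
    · exact hs.write_le y hy _ _ h1 h2
    · obtain rfl := List.mem_singleton.1 hy
      simp at h1
  by_cases hk : s.roundRR ≤ k
  · refine ⟨{ s with roundRR := k }, ⟨v, true, hv, ha, ?_⟩, hvals,
      fun y hy k' v' h1 h2 => (hle y hy k' v' h1 h2).trans hk, ?_, hvalue⟩
    · by_cases hn : s.vRR = none
      · simp [specReadBody, hk, hn]
      · simp [specReadBody, hk, hn, heq hk hn]
    · exact Or.inr ⟨_, List.mem_append_right _ (List.mem_singleton.2 rfl), rfl, Or.inl ⟨v, rfl⟩⟩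
  · refine ⟨s, ⟨v, true, hv, ha, by simp [specReadBody, hk]⟩, hvals, hle, ?_, hvalue⟩
    exact hs.round.imp_right fun ⟨y, hy, h1⟩ => ⟨y, List.mem_append_left _ hy, h1⟩

/-- The current round was set by an earlier successful operation. A read of a round above `k`
responds after the point of this write, by `write_lt_read`. A successful write of a round above `k`
has a point at least as late, and the tie-break puts it after this one if the points agree. -/
theorem Precede.round_le (H : Coherent n h)
    (hT : ∀ y, Recorded h y → TakesEffectAt h y (T y)) {s : SpecState V} (hs : Reaches P s)
    {p i k : ℕ} {v : Option V} (hP : Precede h T P ⟨p, i, .write k v, .wrote true⟩)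
    (hx : Recorded h ⟨p, i, .write k v, .wrote true⟩) : s.roundRR ≤ k := by
  rcases hs.round with h0 | ⟨y, hy, hround, hret⟩
  · omega
  · have hyR := hP.recorded y hy
    have hle := hP.le y hy
    have hTx := hT _ hx
    have hTy := hT _ hyR
    obtain ⟨⟨q1, k1, v1, hk1, hc1⟩, hmax⟩ := hTx
    by_contra hlt
    rw [not_le] at hlt
    have hcases := hyR.cases H
    obtain ⟨p', i', op', r'⟩ := y
    rcases hcases with ⟨k', h1, -⟩ | ⟨k', v', b, h1, h2⟩
    · obtain rfl : op' = .read k' := h1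
      have hk' : k' = s.roundRR := hround
      obtain ⟨v', rfl⟩ : ∃ v', r' = .readOk v' := by
        rcases hret with h2 | h2
        · exact h2
        · rcases hyR.cases H with ⟨_, -, h3 | ⟨v', h3⟩⟩ | ⟨_, _, _, h3, -⟩
          · exact absurd (h2.symm.trans h3) (by simp)
          · exact ⟨v', h3⟩
          · simp at h3
      have := H.write_lt_read _ _ _ _ _ _ _ _ hc1 ⟨_, hyR.1, hTy⟩ (by omega)
      omega
    · obtain rfl : op' = .write k' v' := h1
      obtain rfl : r' = .wrote b := h2
      have hk' : k' = s.roundRR := hround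
      obtain rfl : b = true := by simpa using hret
      have h3 : k' ≤ k ∨ T ⟨p', i', .write k' v', .wrote true⟩ <
          T ⟨p, i, .write k v, .wrote true⟩ := by
        rcases hle with h3 | ⟨-, h3⟩
        · exact Or.inr h3
        · exact Or.inl h3
      rcases h3 with h3 | h3
      · omega
      · have := hTy.2 _ _ _ _ (by omega) hc1
        omega

theorem Precede.mem_vals (H : Coherent n h)
    (hT : ∀ y, Recorded h y → TakesEffectAt h y (T y)) {s : SpecState V} (hs : Reaches P s)
    {p i k : ℕ} {v : Option V} (hP : Precede h T P ⟨p, i, .read k, .readOk v⟩)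
    (hx : Recorded h ⟨p, i, .read k, .readOk v⟩) : v ∈ s.valsRR := by
  have hTx : RespondedAt h p _ i (.readOk v) := hT _ hx
  have hcx : Completed h p _ (.read k) (.readOk v) := ⟨i, hx.1, hTx⟩
  rw [hs.vals]
  refine (H.read_written _ _ _ _ hcx).imp_right ?_
  rintro ⟨k', hk', p', i', hlt, hinv⟩
  -- The write that supplied the value may still be pending; then it is recorded as a failure, which
  -- still adds its value to `valsRR`.
  obtain ⟨b, hb⟩ : ∃ b, Recorded h ⟨p', i', .write k' v, .wrote b⟩ := by
    by_cases hr : ∃ q r, RespondedAt h p' q i' r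
    · obtain ⟨q, r, hr⟩ := hr
      obtain ⟨b, rfl⟩ := H.result _ _ _ _ ⟨_, hinv, hr⟩
      exact ⟨b, hinv, Or.inl ⟨q, hr⟩⟩
    · exact ⟨false, hinv, Or.inr ⟨hr, ⟨k', v, rfl⟩, rfl⟩⟩
  refine ⟨_, hP.mem _ hb ?_, k', rfl⟩
  have hTb := hT _ hb
  match b, hTb with
  | false, hTb => exact (show T _ = p' from hTb).trans_lt hlt
  | true, hTb =>
    obtain ⟨⟨q1, k1, v1, hk1, hc1⟩, -⟩ := hTb
    -- A delayed point is still the invocation of a successful write of round at most `k'`, hence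
    -- below `k`, so it precedes the response of the read.
    exact H.write_lt_read _ _ _ _ _ _ _ _ hc1 hcx (by omega)

/-- It suffices that `vRR` stems from some successful write, not necessarily the last one: `read_eq`
applies to every successful write of a round below `k`. -/
theorem Precede.value_eq (H : Coherent n h) (hd : RoundDiscipline h)
    (hT : ∀ y, Recorded h y → TakesEffectAt h y (T y)) {s : SpecState V} (hs : Reaches P s)
    {p i k : ℕ} {v : Option V} (hP : Precede h T P ⟨p, i, .read k, .readOk v⟩)
    (hx : Recorded h ⟨p, i, .read k, .readOk v⟩) (hk : s.roundRR ≤ k) (hn : s.vRR ≠ none) :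
    v = s.vRR := by
  have hTx : RespondedAt h p _ i (.readOk v) := hT _ hx
  obtain ⟨y, hy, k', h1, h2⟩ := hs.value.resolve_left hn
  have hyR := hP.recorded y hy
  have hky := hs.write_le y hy _ _ h1 h2
  obtain ⟨q, hc⟩ := hyR.completed (by simp [h2])
  rw [h1, h2] at hc
  refine H.read_eq k _ _ _ _ _ _ _ hc ⟨i, hx.1, hTx⟩ (lt_of_le_of_ne (hky.trans hk) ?_)
  -- A write of the same round is invoked only after this read has returned and takes effect no
  -- earlier than its invocation, so it cannot precede the read.
  rintro rfl
  obtain ⟨i', h3, -⟩ := hc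
  obtain ⟨p0, q0, v0, h4, h5, h6, -⟩ := hd.readFirst _ _ _ _ h3
  obtain rfl := hd.readOnce _ _ _ _ _ hx.1 h4
  obtain ⟨rfl, -⟩ := hx.1.unique h4
  obtain ⟨h7, -⟩ := hTx.unique h5
  have h8 := (hT y hyR).pos_le hyR
  rcases hP.le y hy with h9 | ⟨h9, -⟩ <;> omega

theorem Precede.step (H : Coherent n h) (hd : RoundDiscipline h)
    (hT : ∀ y, Recorded h y → TakesEffectAt h y (T y)) {s : SpecState V} (hs : Reaches P s)
    (hP : Precede h T P x) (hx : Recorded h x) :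
    ∃ s', SpecStep n x.node x.op s x.ret s' ∧ Reaches (P ++ [x]) s' := by
  have ha := H.admissible _ _ _ hx.1
  have hc := hx.cases H
  obtain ⟨p, i, op, r⟩ := x
  rcases hc with ⟨k, h1, h2 | ⟨v, h2⟩⟩ | ⟨k, v, b, h1, h2⟩ <;>
    obtain rfl : op = _ := h1 <;> obtain rfl : r = _ := h2
  · exact ⟨s, step_readFail ha hs⟩
  · exact step_readOk ha hs (hP.mem_vals H hT hs hx) (hP.value_eq H hd hT hs hx)
  · cases b
    · exact step_wroteFalse ha.1 ha.2 hs
    · exact step_wroteTrue ha.1 ha.2 hs (hP.round_le H hT hs hx)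

theorem specRun_of_sorted (H : Coherent n h) (hd : RoundDiscipline h)
    (hT : ∀ y, Recorded h y → TakesEffectAt h y (T y)) (L : List (OpRec V)) :
    ∀ (P : List (OpRec V)) (s : SpecState V), Reaches P s →
      (P ++ L).Pairwise (fun x y => T x < T y ∨ T x = T y ∧ x.op.round ≤ y.op.round) →
      (∀ x, x ∈ P ++ L ↔ Recorded h x) → ∃ s', SpecRun (SpecStep n) s L s' := by
  induction L with
  | nil => exact fun P s _ _ _ => ⟨s, .nil s⟩
  | cons x L ih =>
    intro P s hs hsort hmem
    obtain ⟨-, hxL, hPL⟩ := List.pairwise_append.1 hsort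
    have hP : Precede h T P x := by
      refine ⟨fun y hy => (hmem y).1 (List.mem_append_left _ hy),
        fun y hy => hPL y hy x List.mem_cons_self, fun y hy hlt => ?_⟩
      rcases List.mem_append.1 ((hmem y).2 hy) with hy | hy
      · exact hy
      · rcases List.mem_cons.1 hy with rfl | hy
        · exact absurd hlt (lt_irrefl _)
        · have := (List.pairwise_cons.1 hxL).1 y hy
          omega
    obtain ⟨s', h1, h2⟩ := hP.step H hd hT hs
      ((hmem x).1 (List.mem_append_right _ List.mem_cons_self))
    obtain ⟨s'', h3⟩ := ih (P ++ [x]) s' h2 (by simpa using hsort) (by simpa using hmem)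
    exact ⟨s'', .cons h1 h3⟩

end Order

/-! ### Assembling the linearisation -/

theorem Coherent.linearisable (H : Coherent n h) (hd : RoundDiscipline h) :
    Linearisable (SpecStep n) (SpecState.init V) h := by
  classical
  have hex : ∀ x, ∃ t, Recorded h x → TakesEffectAt h x t := fun x => by
    by_cases hx : Recorded h x
    · obtain ⟨t, ht⟩ := hx.exists_takesEffectAt
      exact ⟨t, fun _ => ht⟩
    · exact ⟨0, fun h' => absurd h' hx⟩
  choose T hT using hex
  -- Several successful writes may be delayed to the same point; the second component puts them in
  -- the order of their rounds.
  let key : OpRec V → ℕ ×ₗ ℕ := fun x => toLex (T x, x.op.round)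
  let L := (finite_recorded h).toFinset.toList.insertionSort fun x y => key x ≤ key y
  have hperm : L.Perm (finite_recorded h).toFinset.toList := List.perm_insertionSort _ _
  have hmem : ∀ x, x ∈ L ↔ Recorded h x := fun x => by
    rw [hperm.mem_iff]
    simp
  have : Std.Total fun x y : OpRec V => key x ≤ key y := ⟨fun x y => le_total _ _⟩
  have : IsTrans (OpRec V) fun x y => key x ≤ key y := ⟨fun x y z => le_trans⟩
  have hsort : L.Pairwise fun x y => T x < T y ∨ T x = T y ∧ x.op.round ≤ y.op.round :=
    (List.pairwise_insertionSort _ _).imp fun {x y} hxy => by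
      simpa [key, Prod.Lex.toLex_le_toLex] using hxy
  refine ⟨L, ?_, fun x hx => ((hmem x).1 hx).1, ?_, ?_, ?_⟩
  · refine List.Nodup.map_on (fun x hx y hy hxy => ?_) (hperm.nodup_iff.2 (Finset.nodup_toList _))
    exact Recorded.eq_of_pos_eq ((hmem x).1 hx) ((hmem y).1 hy) hxy
  · exact fun p q i op r h1 h2 => (hmem _).2 ⟨h1, Or.inl ⟨q, h2⟩⟩
  · refine hsort.imp_of_mem fun {x y} hx hy hxy => ?_
    rintro ⟨q, r, h1, h2⟩
    -- If `y` returned before `x` was invoked, its point would be strictly earlier, since each point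
    -- lies between invocation and response.
    have h3 := (hT y ((hmem y).1 hy)).le_response H hd ((hmem y).1 hy) h1
    have h4 := (hT x ((hmem x).1 hx)).pos_le ((hmem x).1 hx)
    omega
  · exact specRun_of_sorted H hd hT L [] _ reaches_init hsort hmem

end RBRegister

theorem mainTheorem2 {V : Type*} (n : ℕ) (h : List (RBRegister.Event V))
    (s : RBRegister.State V) (hexec : RBRegister.Exec n h s)
    (hdisc : RBRegister.RoundDiscipline h) :
    RBRegister.Linearisable (RBRegister.SpecStep n) (RBRegister.SpecState.init V) h :=
  (hexec.coherent hdisc).linearisable hdisc
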